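/- Let $(N,h)$ be a smooth Riemannian manifold without boundary, and let $\mathbb{R}^m$ carry the flat metric. A smooth map $f:\mathbb{R}^m\to N$ is called a (shrinking) soliton of the harmonic map heat flow if its tension field satisfies $$\tau(f)(x)=Tf_x\!\left(\tfrac{x}{2}\right)\qquad\text{for all }x\in\mathbb{R}^m .$$ A $C^2$ function on an open subset of $N$ is strictly convex if its Hessian $\nabla^2F$ (with respect to the Levi-Civita connection of $h$) is positive definite at every point. A set $U\subset N$ is called convex supporting if for every compact $K\subset U$ there is a strictly convex $C^2$ function $F_K$ defined on some open neighbourhood of $K$ in $N$. Let $U\subset N$ be convex supporting (for example, a domain of this kind), and let $f:\mathbb{R}^m\to N$ be a soliton whose image is contained in a compact subset of $U$ (if $N$ is compact, this means that the closure of $f(\mathbb{R}^m)$ is contained in $U$). Then $f$ is constant. -/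

import Mathlib

open scoped Manifold ContDiff

noncomputable section

namespace ConvexSoliton

/-- Euclidean space `ℝ^d`. -/
abbrev Euc (d : ℕ) : Type := EuclideanSpace ℝ (Fin d)

/-- The partial derivative `∂_i φ` of a function on `ℝ^d`. -/
def partialDeriv {d : ℕ} (i : Fin d) (φ : Euc d → ℝ) (z : Euc d) : ℝ :=
  fderiv ℝ φ z (EuclideanSpace.single i 1)

section Manifold

variable {m n : ℕ} {N : Type*} [TopologicalSpace N] [ChartedSpace (Euc n) N]

/-- Smooth Riemannian metrics on the `n`-manifold `N`. -/
abbrev RiemannianMetric (n : ℕ) (N : Type*) [TopologicalSpace N] [ChartedSpace (Euc n) N]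
    [IsManifold 𝓘(ℝ, Euc n) ∞ N] :=
  Bundle.ContMDiffRiemannianMetric 𝓘(ℝ, Euc n) ∞ (Euc n)
    (fun p : N => TangentSpace 𝓘(ℝ, Euc n) p)

/-- The coordinate vector `∂/∂y^i` of the chart `e`, at the point with coordinates `z`. -/
def coordVec (e : OpenPartialHomeomorph N (Euc n)) (z : Euc n) (i : Fin n) :
    TangentSpace 𝓘(ℝ, Euc n) (e.symm z) :=
  mfderiv 𝓘(ℝ, Euc n) 𝓘(ℝ, Euc n) e.symm z (EuclideanSpace.single i (1 : ℝ) : Euc n)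

/-- The smooth charts of `N`. -/
abbrev smoothCharts (n : ℕ) (N : Type*) [TopologicalSpace N] [ChartedSpace (Euc n) N] :
    Set (OpenPartialHomeomorph N (Euc n)) :=
  IsManifold.maximalAtlas 𝓘(ℝ, Euc n) ∞ N

variable [IsManifold 𝓘(ℝ, Euc n) ∞ N]

/-- The metric coefficients `h_{ij} = h(∂_i, ∂_j)` in the chart `e`, as functions of the
coordinates `z`. -/
def metricCoeff (h : RiemannianMetric n N) (e : OpenPartialHomeomorph N (Euc n))
    (z : Euc n) : Matrix (Fin n) (Fin n) ℝ :=
  fun i j => h.inner (e.symm z) (coordVec e z i) (coordVec e z j)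

/-- The Christoffel symbols `Γ^k_{ij}` of the Levi-Civita connection of `h` in the chart `e`:
`Γ^k_{ij} = (1/2) ∑_l h^{kl} (∂_i h_{jl} + ∂_j h_{il} - ∂_l h_{ij})`. -/
def christoffel (h : RiemannianMetric n N) (e : OpenPartialHomeomorph N (Euc n))
    (k i j : Fin n) (z : Euc n) : ℝ :=
  (1 / 2 : ℝ) * ∑ l, (metricCoeff h e z)⁻¹ k l *
    (partialDeriv i (fun w => metricCoeff h e w j l) z
      + partialDeriv j (fun w => metricCoeff h e w i l) z
      - partialDeriv l (fun w => metricCoeff h e w i j) z)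

/-- The components `(∇²F)_{ij} = ∂_i ∂_j F - ∑_k Γ^k_{ij} ∂_k F` of the Hessian of `F` in the
chart `e`, as functions of the coordinates `z`. -/
def hessianCoeff (h : RiemannianMetric n N) (e : OpenPartialHomeomorph N (Euc n))
    (F : N → ℝ) (i j : Fin n) (z : Euc n) : ℝ :=
  partialDeriv i (partialDeriv j (fun w => F (e.symm w))) z
    - ∑ k, christoffel h e k i j z * partialDeriv k (fun w => F (e.symm w)) z

/-- `F` is a strictly convex `C²` function on the open set `V`: its Hessian is positive definite
at every point of `V`. (The values of `F` off `V` play no role.) -/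
structure IsStrictlyConvexOn (h : RiemannianMetric n N) (F : N → ℝ) (V : Set N) : Prop where
  contMDiffOn : ContMDiffOn 𝓘(ℝ, Euc n) 𝓘(ℝ, ℝ) 2 F V
  hessian_pos : ∀ p ∈ V, ∀ e ∈ smoothCharts n N, p ∈ e.source → ∀ v : Euc n, v ≠ 0 →
    0 < ∑ i, ∑ j, hessianCoeff h e F i j (e p) * v i * v j

/-- `U` is convex supporting: every compact subset `K` of `U` admits a strictly convex function,
that is, one defined on some open neighbourhood `V` of `K`. -/
def IsConvexSupporting (h : RiemannianMetric n N) (U : Set N) : Prop :=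
  ∀ K : Set N, K ⊆ U → IsCompact K →
    ∃ (V : Set N) (F : N → ℝ), IsOpen V ∧ K ⊆ V ∧ IsStrictlyConvexOn h F V

/-- The `k`-th coordinate `f^k` of the map `f`, in the chart `e` of the target. -/
def coordFun (e : OpenPartialHomeomorph N (Euc n)) (f : Euc m → N) (k : Fin n) (x : Euc m) : ℝ :=
  e (f x) k

/-- The components `τ(f)^k = Δ f^k + ∑_α ∑_{i,j} Γ^k_{ij}(f) ∂_α f^i ∂_α f^j` of the tension field
of `f : ℝ^m → N` in the chart `e` of the target. -/
def tensionCoeff (h : RiemannianMetric n N) (e : OpenPartialHomeomorph N (Euc n))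
    (f : Euc m → N) (k : Fin n) (x : Euc m) : ℝ :=
  Laplacian.laplacian (coordFun e f k) x
    + ∑ α : Fin m, ∑ i, ∑ j, christoffel h e k i j (e (f x)) *
        partialDeriv α (coordFun e f i) x * partialDeriv α (coordFun e f j) x

/-- `f : ℝ^m → N` is a (shrinking) soliton of the harmonic map heat flow: it is smooth and
`τ(f) = Tf(x/2)`. In a chart the latter reads `τ(f)^k = ∑_α (x^α/2) ∂_α f^k`. -/
structure IsSoliton (h : RiemannianMetric n N) (f : Euc m → N) : Prop where
  contMDiff : ContMDiff 𝓘(ℝ, Euc m) 𝓘(ℝ, Euc n) ∞ f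
  soliton_eq : ∀ x : Euc m, ∀ e ∈ smoothCharts n N, f x ∈ e.source → ∀ k : Fin n,
    tensionCoeff h e f k x = ∑ α : Fin m, x α / 2 * partialDeriv α (coordFun e f k) x

end Manifold

end ConvexSoliton

end

namespace ConvexSoliton

open scoped Topology
open Filter

variable {m n : ℕ}

/-! ### Partial derivatives -/

/-! Take `F` strictly convex near the compact set `K` containing the image, and set `φ = F ∘ f`. The
composition formula gives `Δφ = ∑_α ∇²F(∂_α f, ∂_α f) + dF(τ(f))`, and the soliton equation turns
the last term into `(x/2)·∇φ`. So `Lφ ≥ 0` for `L = Δ - (x/2)·∇` (`IsSoliton.laplacian_comp`), and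
`φ` is bounded above since `K` is compact.

The outward-growing drift forces such a `φ` to be constant (`liouville`), with no bound on `df`. For
any centre `p`, there is a function `w` with `w → ∞` at infinity and `Lw < 0` outside a small ball
about `p`. Comparing `φ` with multiples `εw` shows that outside the ball `φ` exceeds its values on
the sphere by at most `O(ε)`. Letting `ε → 0` and shrinking the ball gives `φ q ≤ φ p` for all `p`,
`q`.

Then `∑_α ∇²F(∂_α f, ∂_α f) = 0`; strict convexity kills every `∂_α f`, and `ℝ^m` is connected. -/

theorem partialDeriv_congr {i : Fin m} {φ ψ : Euc m → ℝ} {x : Euc m} (h : φ =ᶠ[𝓝 x] ψ) :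
    partialDeriv i φ x = partialDeriv i ψ x := by
  simp only [partialDeriv, h.fderiv_eq]

theorem partialDeriv_eventuallyEq {i : Fin m} {φ ψ : Euc m → ℝ} {x : Euc m} (h : φ =ᶠ[𝓝 x] ψ) :
    partialDeriv i φ =ᶠ[𝓝 x] partialDeriv i ψ :=
  h.eventuallyEq_nhds.mono fun _ hy => partialDeriv_congr hy

theorem partialDeriv_sub {i : Fin m} {φ ψ : Euc m → ℝ} {x : Euc m}
    (hφ : DifferentiableAt ℝ φ x) (hψ : DifferentiableAt ℝ ψ x) :
    partialDeriv i (fun y => φ y - ψ y) x = partialDeriv i φ x - partialDeriv i ψ x := by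
  simp only [partialDeriv]
  rw [fderiv_fun_sub hφ hψ]; rfl

theorem partialDeriv_mul {i : Fin m} {φ ψ : Euc m → ℝ} {x : Euc m}
    (hφ : DifferentiableAt ℝ φ x) (hψ : DifferentiableAt ℝ ψ x) :
    partialDeriv i (fun y => φ y * ψ y) x
      = φ x * partialDeriv i ψ x + partialDeriv i φ x * ψ x := by
  simp only [partialDeriv]
  rw [fderiv_fun_mul hφ hψ]
  simp [mul_comm]

theorem partialDeriv_sum {ι : Type*} {s : Finset ι} {i : Fin m} {φ : ι → Euc m → ℝ} {x : Euc m}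
    (hφ : ∀ k ∈ s, DifferentiableAt ℝ (φ k) x) :
    partialDeriv i (fun y => ∑ k ∈ s, φ k y) x = ∑ k ∈ s, partialDeriv i (φ k) x := by
  simp only [partialDeriv]
  rw [fderiv_fun_sum hφ]
  simp

theorem _root_.ContDiffAt.partialDeriv {i : Fin m} {φ : Euc m → ℝ} {x : Euc m} {k l : ℕ∞ω}
    (hφ : ContDiffAt ℝ k φ x) (hl : l + 1 ≤ k) : ContDiffAt ℝ l (partialDeriv i φ) x :=
  (hφ.fderiv_right hl).clm_apply contDiffAt_const

theorem fderiv_apply_eq_sum_partialDeriv (φ : Euc m → ℝ) (x v : Euc m) :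
    fderiv ℝ φ x v = ∑ i, v i * partialDeriv i φ x := by
  have hv : v = ∑ i, v i • EuclideanSpace.single i (1 : ℝ) := by
    ext j
    simp [Pi.single_apply]
  conv_lhs => rw [hv]
  simp only [map_sum, map_smul, smul_eq_mul, partialDeriv]

theorem laplacian_eq_sum_partialDeriv {φ : Euc m → ℝ} {x : Euc m} (hφ : ContDiffAt ℝ 2 φ x) :
    Laplacian.laplacian φ x = ∑ i, partialDeriv i (partialDeriv i φ) x := by
  rw [InnerProductSpace.laplacian_eq_iteratedFDeriv_orthonormalBasis φ
    (EuclideanSpace.basisFun (Fin m) ℝ)]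
  refine Finset.sum_congr rfl fun i _ => ?_
  rw [iteratedFDeriv_two_apply]
  have hd : DifferentiableAt ℝ (fderiv ℝ φ) x :=
    (hφ.fderiv_right (m := 1) (by norm_num)).differentiableAt (by norm_num)
  simp only [partialDeriv]
  change _ = fderiv ℝ (fun z => fderiv ℝ φ z (EuclideanSpace.single i 1)) x _
  rw [fderiv_clm_apply hd (differentiableAt_const _)]
  simp

/-- The chain rule for partial derivatives. -/
theorem partialDeriv_comp {i : Fin m} {G : Euc n → ℝ} {u : Euc m → Euc n} {x : Euc m}
    (hG : DifferentiableAt ℝ G (u x)) (hu : DifferentiableAt ℝ u x) :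
    partialDeriv i (fun y => G (u y)) x
      = ∑ k, partialDeriv k G (u x) * partialDeriv i (fun y => u y k) x := by
  have h1 : fderiv ℝ (fun y => G (u y)) x = (fderiv ℝ G (u x)).comp (fderiv ℝ u x) :=
    fderiv_comp x hG hu
  have h2 : ∀ k, fderiv ℝ (fun y => u y k) x
      = (EuclideanSpace.proj k : Euc n →L[ℝ] ℝ).comp (fderiv ℝ u x) := fun k =>
    ((EuclideanSpace.proj k : Euc n →L[ℝ] ℝ).hasFDerivAt.comp x hu.hasFDerivAt).fderiv
  simp only [partialDeriv, h1, h2]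
  simp only [ContinuousLinearMap.comp_apply]
  rw [fderiv_apply_eq_sum_partialDeriv]
  refine Finset.sum_congr rfl fun k _ => ?_
  simp [partialDeriv, mul_comm]

/-! ### The maximum principle -/

/-- A positive second derivative would make `t` a local minimum as well, so `g` would be locally
constant and its second derivative zero. -/
theorem _root_.IsLocalMax.deriv_deriv_nonpos {g : ℝ → ℝ} {t : ℝ} (h : IsLocalMax g t)
    (hc : ContinuousAt g t) : deriv (deriv g) t ≤ 0 := by
  by_contra! hpos
  have hmin := isLocalMin_of_deriv_deriv_pos hpos h.deriv_eq_zero hc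
  have hconst : g =ᶠ[𝓝 t] fun _ => g t := by
    filter_upwards [h, hmin] with y h1 h2 using le_antisymm h1 h2
  have h0 : deriv (deriv g) t = 0 := by
    rw [hconst.deriv.deriv_eq]
    simp
  exact hpos.ne' h0

theorem _root_.IsLocalMax.partialDeriv_partialDeriv_nonpos {i : Fin m} {φ : Euc m → ℝ} {x : Euc m}
    (h : IsLocalMax φ x) (hφ : ContDiff ℝ 2 φ) : partialDeriv i (partialDeriv i φ) x ≤ 0 := by
  set v : Euc m := EuclideanSpace.single i 1
  have hl : ∀ t : ℝ, HasDerivAt (fun s : ℝ => x + s • v) v t := fun t => by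
    simpa using ((hasDerivAt_id t).smul_const v).const_add x
  have hd : ∀ (ψ : Euc m → ℝ), Differentiable ℝ ψ → ∀ t : ℝ,
      deriv (fun s : ℝ => ψ (x + s • v)) t = partialDeriv i ψ (x + t • v) := fun ψ hψ t =>
    ((hψ _).hasFDerivAt.comp_hasDerivAt t (hl t)).deriv
  have hp : Differentiable ℝ (partialDeriv i φ) := fun y =>
    (hφ.contDiffAt.partialDeriv (l := 1) (by norm_num)).differentiableAt (by norm_num)
  have h2 := hd (partialDeriv i φ) hp 0
  rw [← funext (hd φ (hφ.differentiable (by norm_num))), zero_smul, add_zero] at h2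
  rw [← h2]
  have hcl : Continuous (fun s : ℝ => x + s • v) := by fun_prop
  refine IsLocalMax.deriv_deriv_nonpos ?_ (hφ.continuous.comp hcl).continuousAt
  have ht : Tendsto (fun s : ℝ => x + s • v) (𝓝 0) (𝓝 x) := by
    simpa using hcl.tendsto 0
  filter_upwards [ht.eventually h] with s hs
  simpa using hs

/-! ### A barrier for the operator `Δ - (x/2)·∇` -/

/-- The function `s - A exp(-a s)` of the squared distance `s` to the point `p`. -/
noncomputable def barrier (A a : ℝ) (p : Euc m) (x : Euc m) : ℝ :=
  ‖x - p‖ ^ 2 - A * Real.exp (-a * ‖x - p‖ ^ 2)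

theorem contDiff_barrier (A a : ℝ) (p : Euc m) : ContDiff ℝ 2 (barrier A a p) := by
  have h : ContDiff ℝ 2 (fun x : Euc m => ‖x - p‖ ^ 2) :=
    (contDiff_id.sub contDiff_const).norm_sq ℝ
  exact h.sub (contDiff_const.mul (contDiff_const.mul h).exp)

theorem partialDeriv_normSq (i : Fin m) (p x : Euc m) :
    partialDeriv i (fun y => ‖y - p‖ ^ 2) x = 2 * (x i - p i) := by
  have h := (((hasFDerivAt_id x).sub_const p).norm_sq).fderiv
  simp only [id] at h
  simp only [partialDeriv, h]
  simp [EuclideanSpace.inner_single_right]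

theorem partialDeriv_exp_normSq (a : ℝ) (i : Fin m) (p x : Euc m) :
    partialDeriv i (fun y => Real.exp (-a * ‖y - p‖ ^ 2)) x
      = -2 * a * (x i - p i) * Real.exp (-a * ‖x - p‖ ^ 2) := by
  have hd : DifferentiableAt ℝ (fun y : Euc m => ‖y - p‖ ^ 2) x :=
    ((contDiff_id.sub contDiff_const).norm_sq ℝ (n := 1)).differentiable (by norm_num) x
  have h := ((hd.hasFDerivAt.const_mul (-a)).exp).fderiv
  have h2 := partialDeriv_normSq i p x
  simp only [partialDeriv] at h2 ⊢
  rw [h]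
  simp only [smul_apply, smul_eq_mul, h2]
  ring

theorem partialDeriv_barrier (A a : ℝ) (i : Fin m) (p x : Euc m) :
    partialDeriv i (barrier A a p) x
      = (2 + 2 * A * a * Real.exp (-a * ‖x - p‖ ^ 2)) * (x i - p i) := by
  have hd : Differentiable ℝ (fun y : Euc m => ‖y - p‖ ^ 2) :=
    ((contDiff_id.sub contDiff_const).norm_sq ℝ (n := 1)).differentiable (by norm_num)
  have he : Differentiable ℝ (fun y : Euc m => Real.exp (-a * ‖y - p‖ ^ 2)) :=
    (hd.const_mul (-a)).exp
  unfold barrier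
  rw [partialDeriv_sub (hd x) ((he x).const_mul A), partialDeriv_mul (differentiableAt_const A) (he x),
    partialDeriv_normSq, partialDeriv_exp_normSq]
  simp [partialDeriv]
  ring

theorem partialDeriv_partialDeriv_barrier (A a : ℝ) (i : Fin m) (p x : Euc m) :
    partialDeriv i (partialDeriv i (barrier A a p)) x
      = 2 + 2 * A * a * Real.exp (-a * ‖x - p‖ ^ 2)
        - 4 * A * a ^ 2 * Real.exp (-a * ‖x - p‖ ^ 2) * (x i - p i) ^ 2 := by
  rw [show partialDeriv i (barrier A a p) = _ from funext (partialDeriv_barrier A a i p)]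
  have hd : Differentiable ℝ (fun y : Euc m => ‖y - p‖ ^ 2) :=
    ((contDiff_id.sub contDiff_const).norm_sq ℝ (n := 1)).differentiable (by norm_num)
  have he : Differentiable ℝ (fun y : Euc m => Real.exp (-a * ‖y - p‖ ^ 2)) :=
    (hd.const_mul (-a)).exp
  have hc : HasFDerivAt (fun y : Euc m => y i - p i) (EuclideanSpace.proj i : Euc m →L[ℝ] ℝ) x :=
    (EuclideanSpace.proj i : Euc m →L[ℝ] ℝ).hasFDerivAt.sub_const _
  have h1 : partialDeriv i (fun y : Euc m => y i - p i) x = 1 := by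
    simp [partialDeriv, hc.fderiv]
  have h2 : partialDeriv i (fun y : Euc m => 2 + 2 * A * a * Real.exp (-a * ‖y - p‖ ^ 2)) x
      = 2 * A * a * (-2 * a * (x i - p i) * Real.exp (-a * ‖x - p‖ ^ 2)) := by
    rw [← partialDeriv_exp_normSq]
    simp only [partialDeriv]
    rw [fderiv_const_add, fderiv_const_mul (he x)]
    simp
  rw [partialDeriv_mul (((he x).const_mul _).const_add _) hc.differentiableAt, h1, h2]
  ring

theorem norm_sub_sq_eq_sum (p x : Euc m) : ‖x - p‖ ^ 2 = ∑ i, (x i - p i) ^ 2 := by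
  simp [EuclideanSpace.norm_sq_eq]

/-- Away from `p` the barrier is, for suitable parameters, a strict supersolution. -/
theorem exists_barrier_supersolution (p : Euc m) {r : ℝ} (hr : 0 < r) :
    ∃ A a : ℝ, 0 < A ∧ 0 < a ∧ ∀ x : Euc m, r ≤ ‖x - p‖ →
      ∑ i, partialDeriv i (partialDeriv i (barrier A a p)) x
        < ∑ i, x i / 2 * partialDeriv i (barrier A a p) x := by
  -- `C` is chosen so that `2m - T ≤ C - 1 - s/2`; `a` so that the second-order gain `4aKs` is at
  -- least `KC` once `s ≥ r²`; `A` so that `K ≥ C` as long as `s ≤ 2C`.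
  set C : ℝ := 2 * m + ‖p‖ ^ 2 / 2 + 1 with hC
  have hCpos : 0 < C := by positivity
  set a : ℝ := C / (4 * r ^ 2) with ha
  have hapos : 0 < a := by positivity
  set A : ℝ := C * Real.exp (2 * a * C) / a with hA
  have hApos : 0 < A := by positivity
  have hAa : A * a = C * Real.exp (2 * a * C) := by rw [hA]; field_simp
  have har : 4 * r ^ 2 * a = C := by rw [ha]; field_simp
  refine ⟨A, a, hApos, hapos, fun x hx => ?_⟩
  set s : ℝ := ‖x - p‖ ^ 2 with hs
  have hrs : r ^ 2 ≤ s := pow_le_pow_left₀ hr.le hx 2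
  have hs0 : 0 < s := lt_of_lt_of_le (by positivity) hrs
  set K : ℝ := A * a * Real.exp (-a * s) with hK
  have hKpos : 0 < K := by positivity
  set T : ℝ := ∑ i, x i * (x i - p i) with hT
  have hTs : s / 2 - ‖p‖ ^ 2 / 2 ≤ T := by
    -- Polarization: `x·(x - p) = (‖x‖² + ‖x - p‖² - ‖p‖²)/2`.
    have h : T - s / 2 + ‖p‖ ^ 2 / 2 = ∑ i, x i ^ 2 / 2 := by
      rw [hT, hs, norm_sub_sq_eq_sum, EuclideanSpace.norm_sq_eq, Finset.sum_div, Finset.sum_div,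
        ← Finset.sum_sub_distrib, ← Finset.sum_add_distrib]
      refine Finset.sum_congr rfl fun i _ => ?_
      rw [Real.norm_eq_abs, sq_abs]
      ring
    have : 0 ≤ ∑ i, x i ^ 2 / 2 := Finset.sum_nonneg fun i _ => by positivity
    linarith
  have hlap : ∑ i, partialDeriv i (partialDeriv i (barrier A a p)) x
      = 2 * m * (1 + K) - 4 * a * K * s := by
    simp only [partialDeriv_partialDeriv_barrier]
    rw [Finset.sum_sub_distrib, ← Finset.mul_sum, ← norm_sub_sq_eq_sum, ← hs]
    simp only [Finset.sum_const, Finset.card_univ, Fintype.card_fin, nsmul_eq_mul, hK]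
    ring
  have hdrift : ∑ i, x i / 2 * partialDeriv i (barrier A a p) x = (1 + K) * T := by
    simp only [partialDeriv_barrier]
    rw [hT, Finset.mul_sum]
    refine Finset.sum_congr rfl fun i _ => ?_
    simp only [hK, hs]
    ring
  rw [hlap, hdrift]
  -- For `s ≥ 2C` the quadratic term alone makes the left side negative. For `s ≤ 2C` the
  -- exponential term is needed: `(1 + K)(C - 1) = KC + C - 1 - K`, and `K ≥ C`.
  have h1 : (1 + K) * (C - 1 - s / 2) < K * C := by
    rcases le_total (2 * C) s with h | h
    · nlinarith
    · have hKC : C ≤ K := by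
        have he : 1 ≤ Real.exp (2 * a * C) * Real.exp (-a * s) := by
          rw [← Real.exp_add]
          exact Real.one_le_exp (by nlinarith)
        rw [hK, hAa]
        nlinarith
      nlinarith
  have h2 : K * C ≤ 4 * a * K * s := by
    have : C ≤ 4 * a * s := by nlinarith
    nlinarith
  have h3 : (1 + K) * (2 * m - T) ≤ (1 + K) * (C - 1 - s / 2) :=
    mul_le_mul_of_nonneg_left (by linarith) (by positivity)
  linarith

/-! ### The Liouville theorem -/

/-- A `C²` function bounded above with `Δφ - (x/2)·∇φ ≥ 0` is constant. -/
theorem liouville {φ : Euc m → ℝ} (hφ : ContDiff ℝ 2 φ) {B : ℝ} (hB : ∀ x, φ x ≤ B)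
    (hL : ∀ x, ∑ i, x i / 2 * partialDeriv i φ x ≤ ∑ i, partialDeriv i (partialDeriv i φ) x)
    (x y : Euc m) : φ x = φ y := by
  suffices H : ∀ p q, φ q ≤ φ p from le_antisymm (H y x) (H x y)
  clear x y
  intro p q
  refine le_of_forall_pos_le_add fun η hη => ?_
  obtain ⟨r, hr, hball⟩ : ∃ r > 0, ∀ x, ‖x - p‖ ≤ r → φ x ≤ φ p + η := by
    obtain ⟨r, hr, h⟩ := Metric.continuous_iff.1 hφ.continuous p η hη
    refine ⟨r / 2, by positivity, fun x hx => ?_⟩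
    have := h x (by rw [dist_eq_norm]; linarith)
    rw [Real.dist_eq] at this
    linarith [(abs_lt.1 this).2]
  rcases le_total ‖q - p‖ r with hq | hq
  · exact hball q hq
  obtain ⟨A, a, hA, ha, hW⟩ := exists_barrier_supersolution p hr
  refine le_of_forall_pos_le_add fun δ hδ => ?_
  set w : Euc m → ℝ := barrier A a p with hw
  have hwc : ContDiff ℝ 2 w := contDiff_barrier A a p
  obtain ⟨ε, hε, hεδ⟩ : ∃ ε > 0, ε * (w q + A) ≤ δ := by
    refine ⟨δ / (|w q + A| + 1), by positivity, ?_⟩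
    rw [div_mul_eq_mul_div, div_le_iff₀ (by positivity)]
    nlinarith [le_abs_self (w q + A)]
  have hwpos : ∀ x, ‖x - p‖ ^ 2 ≤ w x + A := fun x => by
    have : Real.exp (-a * ‖x - p‖ ^ 2) ≤ 1 := Real.exp_le_one_iff.2 (by nlinarith [sq_nonneg ‖x - p‖])
    simp only [hw, barrier]
    nlinarith
  -- Adding `A` makes the subtracted term nonnegative, so `ψ ≤ φ` everywhere.
  set ψ : Euc m → ℝ := fun x => φ x - ε * (w x + A) with hψ
  have hψc : ContDiff ℝ 2 ψ := hφ.sub (contDiff_const.mul (hwc.add contDiff_const))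
  suffices hψq : ψ q ≤ φ p + η by
    simp only [hψ] at hψq
    linarith
  by_contra! hcon
  -- `ψ → -∞` at infinity, so a maximum over the closed exterior exists. It is not on the sphere,
  -- where `ψ ≤ φ ≤ φ p + η < ψ q`.
  obtain ⟨z, hzr, hz⟩ : ∃ z, r < ‖z - p‖ ∧ ∀ x, r ≤ ‖x - p‖ → ψ x ≤ ψ z := by
    have hcl : IsClosed {x : Euc m | r ≤ ‖x - p‖} :=
      isClosed_le continuous_const (by fun_prop)
    have hlim : ∀ᶠ x in cocompact (Euc m) ⊓ 𝓟 {x : Euc m | r ≤ ‖x - p‖}, ψ x ≤ ψ q := by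
      refine Eventually.filter_mono inf_le_left ?_
      have hR : Tendsto (fun x : Euc m => ε * ‖x - p‖ ^ 2) (cocompact (Euc m)) atTop := by
        refine Tendsto.const_mul_atTop hε ((tendsto_pow_atTop two_ne_zero).comp ?_)
        have h1 : Tendsto (fun x : Euc m => dist x p) (cocompact (Euc m)) atTop :=
          tendsto_dist_right_cocompact_atTop p
        simpa only [dist_eq_norm] using h1
      filter_upwards [hR.eventually_ge_atTop (B - ψ q)] with x hx
      have := hwpos x
      have := hB x
      simp only [hψ] at hx ⊢
      nlinarith
    obtain ⟨z, hzmem, hz⟩ := hψc.continuous.continuousOn.exists_isMaxOn' hcl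
      (x₀ := q) hq hlim
    refine ⟨z, lt_of_le_of_ne hzmem fun hne => ?_, fun x hx => hz hx⟩
    have h1 : ψ q ≤ ψ z := hz hq
    have h2 := hball z hne.ge
    have h3 := hwpos z
    have h4 : ψ z ≤ φ z := by
      simp only [hψ]
      nlinarith [sq_nonneg ‖z - p‖]
    linarith
  have hloc : IsLocalMax ψ z := by
    have ho : {x : Euc m | r < ‖x - p‖} ∈ 𝓝 z :=
      (isOpen_lt continuous_const (by fun_prop)).mem_nhds hzr
    filter_upwards [ho] with x hx using hz x hx.le
  have hwd : Differentiable ℝ (fun x => ε * (w x + A)) :=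
    ((hwc.differentiable (by norm_num)).add_const A).const_mul ε
  have hpd1 : ∀ i, partialDeriv i ψ = fun x => partialDeriv i φ x - ε * partialDeriv i w x := by
    intro i
    funext x
    rw [partialDeriv_sub (hφ.differentiable (by norm_num) x) (hwd x)]
    congr 1
    simp only [partialDeriv]
    rw [fderiv_const_mul ((hwc.differentiable (by norm_num) x).add_const A), fderiv_add_const]
    simp
  have hpd2 : ∀ i, partialDeriv i (partialDeriv i ψ) z
      = partialDeriv i (partialDeriv i φ) z - ε * partialDeriv i (partialDeriv i w) z := by
    intro i
    have d1 : DifferentiableAt ℝ (partialDeriv i φ) z :=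
      (hφ.contDiffAt.partialDeriv (l := 1) (by norm_num)).differentiableAt (by norm_num)
    have d2 : DifferentiableAt ℝ (partialDeriv i w) z :=
      (hwc.contDiffAt.partialDeriv (l := 1) (by norm_num)).differentiableAt (by norm_num)
    rw [hpd1, partialDeriv_sub d1 (d2.const_mul ε), partialDeriv_mul (differentiableAt_const ε) d2]
    simp [partialDeriv]
  have h0 : ∀ i, partialDeriv i φ z = ε * partialDeriv i w z := fun i => by
    have : partialDeriv i ψ z = 0 := by simp [partialDeriv, hloc.fderiv_eq_zero]
    rw [hpd1] at this
    linarith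
  have hle : ∀ i, partialDeriv i (partialDeriv i φ) z ≤ ε * partialDeriv i (partialDeriv i w) z :=
    fun i => by
      have := hloc.partialDeriv_partialDeriv_nonpos (i := i) hψc
      rw [hpd2] at this
      linarith
  -- At the interior maximum `z`, `∇φ = ε∇w` and `Δφ ≤ εΔw`, so `Lφ ≤ εLw < 0`, against `Lφ ≥ 0`.
  have h1 := hL z
  have h2 := mul_lt_mul_of_pos_left (hW z hzr.le) hε
  have h3 := Finset.sum_le_sum fun i (_ : i ∈ Finset.univ) => hle i
  rw [← Finset.mul_sum] at h3
  have h4 : ∑ i, z i / 2 * partialDeriv i φ z = ε * ∑ i, z i / 2 * partialDeriv i w z := by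
    rw [Finset.mul_sum]
    exact Finset.sum_congr rfl fun i _ => by rw [h0]; ring
  linarith

/-! ### Maps into a Riemannian manifold -/

/-- The chain rule for pure second partial derivatives. -/
theorem partialDeriv_partialDeriv_comp {i : Fin m} {G : Euc n → ℝ} {u : Euc m → Euc n} {x : Euc m}
    (hG : ContDiffAt ℝ 2 G (u x)) (hu : ContDiffAt ℝ 2 u x) :
    partialDeriv i (partialDeriv i (fun y => G (u y))) x
      = ∑ k, ((∑ j, partialDeriv j (partialDeriv k G) (u x) * partialDeriv i (fun y => u y j) x)
            * partialDeriv i (fun y => u y k) x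
          + partialDeriv k G (u x) * partialDeriv i (partialDeriv i (fun y => u y k)) x) := by
  have huk : ∀ k, ContDiffAt ℝ 2 (fun y => u y k) x := fun k =>
    (EuclideanSpace.proj k : Euc n →L[ℝ] ℝ).contDiff.contDiffAt.comp x hu
  have hev : partialDeriv i (fun y => G (u y)) =ᶠ[𝓝 x]
      fun y => ∑ k, partialDeriv k G (u y) * partialDeriv i (fun y => u y k) y := by
    have h1 : ∀ᶠ y in 𝓝 x, ContDiffAt ℝ 2 G (u y) :=
      hu.continuousAt.eventually (hG.eventually (by decide))
    filter_upwards [h1, hu.eventually (by decide)] with y hy hy'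
    exact partialDeriv_comp (hy.differentiableAt (by norm_num)) (hy'.differentiableAt (by norm_num))
  rw [partialDeriv_congr hev]
  have hdG : ∀ k, DifferentiableAt ℝ (partialDeriv k G) (u x) := fun k =>
    (hG.partialDeriv (l := 1) (by norm_num)).differentiableAt (by norm_num)
  have hdu : DifferentiableAt ℝ u x := hu.differentiableAt (by norm_num)
  have hdGu : ∀ k, DifferentiableAt ℝ (fun y => partialDeriv k G (u y)) x := fun k =>
    (hdG k).comp x hdu
  have hduk : ∀ k, DifferentiableAt ℝ (partialDeriv i (fun y => u y k)) x := fun k =>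
    ((huk k).partialDeriv (l := 1) (by norm_num)).differentiableAt (by norm_num)
  rw [partialDeriv_sum fun k _ => (hdGu k).fun_mul (hduk k)]
  refine Finset.sum_congr rfl fun k _ => ?_
  rw [partialDeriv_mul (hdGu k) (hduk k), partialDeriv_comp (hdG k) hdu]
  ring

variable {N : Type*} [TopologicalSpace N] [ChartedSpace (Euc n) N]

theorem contDiffAt_chart_comp {f : Euc m → N} (hf : ContMDiff 𝓘(ℝ, Euc m) 𝓘(ℝ, Euc n) ∞ f)
    {e : OpenPartialHomeomorph N (Euc n)} (he : e ∈ smoothCharts n N) {x : Euc m}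
    (hx : f x ∈ e.source) : ContDiffAt ℝ ∞ (fun y => e (f y)) x :=
  ((contMDiffAt_of_mem_maximalAtlas he hx).comp x (hf x)).contDiffAt

theorem contDiffAt_comp_chart_symm {F : N → ℝ} {V : Set N} (hV : IsOpen V)
    (hF : ContMDiffOn 𝓘(ℝ, Euc n) 𝓘(ℝ, ℝ) 2 F V)
    {e : OpenPartialHomeomorph N (Euc n)} (he : e ∈ smoothCharts n N) {p : N}
    (hp : p ∈ e.source) (hpV : p ∈ V) : ContDiffAt ℝ 2 (fun w => F (e.symm w)) (e p) := by
  have h1 : ContMDiffAt 𝓘(ℝ, Euc n) 𝓘(ℝ, Euc n) 2 e.symm (e p) :=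
    (contMDiffAt_symm_of_mem_maximalAtlas he (e.map_source hp)).of_le (by norm_cast)
  have h2 : ContMDiffAt 𝓘(ℝ, Euc n) 𝓘(ℝ, ℝ) 2 F (e.symm (e p)) := by
    rw [e.left_inv hp]
    exact hF.contMDiffAt (hV.mem_nhds hpV)
  exact (h2.comp (e p) h1).contDiffAt

variable [IsManifold 𝓘(ℝ, Euc n) ∞ N]

/-- The composite of a map `f` with a function `F` satisfies
`Δ(F ∘ f) = ∑_α ∇²F(∂_α f, ∂_α f) + dF(τ(f))`. -/
theorem laplacian_comp_eq (h : RiemannianMetric n N) {f : Euc m → N} {F : N → ℝ}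
    {e : OpenPartialHomeomorph N (Euc n)} {x : Euc m} (hx : f x ∈ e.source)
    (hf : ContinuousAt f x) (hu : ContDiffAt ℝ 2 (fun y => e (f y)) x)
    (hG : ContDiffAt ℝ 2 (fun w => F (e.symm w)) (e (f x))) :
    ∑ α, partialDeriv α (partialDeriv α (fun y => F (f y))) x
      = ∑ α, ∑ i, ∑ j, hessianCoeff h e F i j (e (f x)) *
            partialDeriv α (coordFun e f i) x * partialDeriv α (coordFun e f j) x
        + ∑ k, partialDeriv k (fun w => F (e.symm w)) (e (f x)) * tensionCoeff h e f k x := by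
  set G : Euc n → ℝ := fun w => F (e.symm w) with hGdef
  set u : Euc m → Euc n := fun y => e (f y) with hudef
  have hφ : (fun y => F (f y)) =ᶠ[𝓝 x] fun y => G (u y) := by
    filter_upwards [hf.eventually (e.open_source.mem_nhds hx)] with y hy
    simp only [hGdef, hudef, e.left_inv hy]
  have huk : ∀ k, ContDiffAt ℝ 2 (coordFun e f k) x := fun k =>
    (EuclideanSpace.proj k : Euc n →L[ℝ] ℝ).contDiff.contDiffAt.comp x hu
  have hL : ∀ α, partialDeriv α (partialDeriv α (fun y => F (f y))) x
      = ∑ i, ∑ j, partialDeriv i (partialDeriv j G) (u x) *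
            partialDeriv α (coordFun e f i) x * partialDeriv α (coordFun e f j) x
        + ∑ k, partialDeriv k G (u x) * partialDeriv α (partialDeriv α (coordFun e f k)) x := by
    intro α
    rw [partialDeriv_congr (partialDeriv_eventuallyEq hφ), partialDeriv_partialDeriv_comp hG hu,
      Finset.sum_add_distrib, Finset.sum_comm (s := Finset.univ (α := Fin n))]
    congr 1
    exact Finset.sum_congr rfl fun k _ => by rw [Finset.sum_mul]; rfl
  simp only [hL, tensionCoeff, hessianCoeff, laplacian_eq_sum_partialDeriv (huk _)]
  -- The Christoffel terms of the Hessian are split off here; they cancel those of the tension field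
  -- paired with `dF`. No property of the symbols is used.
  have hA : ∀ α : Fin m, ∑ i, ∑ j, (partialDeriv i (partialDeriv j G) (e (f x))
        - ∑ k, christoffel h e k i j (e (f x)) * partialDeriv k G (e (f x))) *
          partialDeriv α (coordFun e f i) x * partialDeriv α (coordFun e f j) x
      = ∑ i, ∑ j, partialDeriv i (partialDeriv j G) (u x) *
            partialDeriv α (coordFun e f i) x * partialDeriv α (coordFun e f j) x
        - ∑ k, partialDeriv k G (e (f x)) * ∑ i, ∑ j, christoffel h e k i j (e (f x)) *
          partialDeriv α (coordFun e f i) x * partialDeriv α (coordFun e f j) x := by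
    intro α
    simp only [sub_mul, Finset.sum_sub_distrib, Finset.sum_mul, Finset.mul_sum]
    congr 1
    rw [Finset.sum_comm (s := Finset.univ (α := Fin n)) (t := Finset.univ (α := Fin n))
      (f := fun k i => ∑ j, partialDeriv k G (e (f x)) * (christoffel h e k i j (e (f x)) *
          partialDeriv α (coordFun e f i) x * partialDeriv α (coordFun e f j) x))]
    refine Finset.sum_congr rfl fun i _ => ?_
    rw [Finset.sum_comm]
    refine Finset.sum_congr rfl fun j _ => Finset.sum_congr rfl fun k _ => ?_
    ring
  rw [Finset.sum_congr rfl fun α _ => hA α]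
  simp only [mul_add, Finset.sum_add_distrib, Finset.sum_sub_distrib]
  have hB : ∀ c : Fin m → Fin n → ℝ, ∑ k, partialDeriv k G (e (f x)) * ∑ α, c α k
      = ∑ α, ∑ k, partialDeriv k G (e (f x)) * c α k := fun c => by
    simp only [Finset.mul_sum]
    exact Finset.sum_comm
  rw [hB fun α k => partialDeriv α (partialDeriv α (coordFun e f k)) x,
    hB fun α k => ∑ i, ∑ j, christoffel h e k i j (e (f x)) *
          partialDeriv α (coordFun e f i) x * partialDeriv α (coordFun e f j) x]
  ring

/-- `F ∘ f` satisfies `Δ(F ∘ f) - (x/2)·∇(F ∘ f) = ∑_α ∇²F(∂_α f, ∂_α f)` for a soliton `f`. -/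
theorem IsSoliton.laplacian_comp {h : RiemannianMetric n N} {f : Euc m → N} (hf : IsSoliton h f)
    {F : N → ℝ} {V : Set N} (hV : IsOpen V) (hF : ContMDiffOn 𝓘(ℝ, Euc n) 𝓘(ℝ, ℝ) 2 F V)
    {e : OpenPartialHomeomorph N (Euc n)} (he : e ∈ smoothCharts n N) {x : Euc m}
    (hx : f x ∈ e.source) (hxV : f x ∈ V) :
    ∑ α, partialDeriv α (partialDeriv α (fun y => F (f y))) x
      = ∑ α, ∑ i, ∑ j, hessianCoeff h e F i j (e (f x)) *
            partialDeriv α (coordFun e f i) x * partialDeriv α (coordFun e f j) x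
        + ∑ α, x α / 2 * partialDeriv α (fun y => F (f y)) x := by
  have hu : ContDiffAt ℝ ∞ (fun y => e (f y)) x := contDiffAt_chart_comp hf.contMDiff he hx
  have hG := contDiffAt_comp_chart_symm hV hF he hx hxV
  have hc : ContinuousAt f x := hf.contMDiff.continuous.continuousAt
  rw [laplacian_comp_eq h hx hc (hu.of_le (by norm_cast)) hG]
  congr 1
  have hφ : (fun y => F (f y)) =ᶠ[𝓝 x] fun y => (fun w => F (e.symm w)) (e (f y)) := by
    filter_upwards [hc.eventually (e.open_source.mem_nhds hx)] with y hy
    simp only [e.left_inv hy]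
  have hd : ∀ α, partialDeriv α (fun y => F (f y)) x
      = ∑ k, partialDeriv k (fun w => F (e.symm w)) (e (f x)) *
        partialDeriv α (coordFun e f k) x := fun α => by
    rw [partialDeriv_congr hφ]
    exact partialDeriv_comp (hG.differentiableAt (by norm_num)) (hu.differentiableAt (by norm_num))
  simp only [hf.soliton_eq x e he hx, hd, Finset.mul_sum]
  rw [Finset.sum_comm]
  exact Finset.sum_congr rfl fun α _ => Finset.sum_congr rfl fun k _ => by ring

theorem IsStrictlyConvexOn.hessian_nonneg {h : RiemannianMetric n N} {F : N → ℝ} {V : Set N}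
    (hF : IsStrictlyConvexOn h F V) {p : N} (hp : p ∈ V) {e : OpenPartialHomeomorph N (Euc n)}
    (he : e ∈ smoothCharts n N) (hpe : p ∈ e.source) (v : Euc n) :
    0 ≤ ∑ i, ∑ j, hessianCoeff h e F i j (e p) * v i * v j := by
  rcases eq_or_ne v 0 with rfl | hv
  · simp
  · exact (hF.hessian_pos p hp e he hpe v hv).le

/-- A map whose partial derivatives vanish in charts is constant. -/
theorem exists_eq_const_of_partialDeriv_eq_zero {f : Euc m → N}
    (hf : ContMDiff 𝓘(ℝ, Euc m) 𝓘(ℝ, Euc n) ∞ f)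
    (h0 : ∀ x, ∀ e ∈ smoothCharts n N, f x ∈ e.source → ∀ α k,
      partialDeriv α (coordFun e f k) x = 0) : ∃ p, ∀ x, f x = p := by
  have hloc : IsLocallyConstant f := by
    refine (IsLocallyConstant.iff_eventually_eq f).2 fun x => ?_
    set e := chartAt (Euc n) (f x)
    have he : e ∈ smoothCharts n N := IsManifold.chart_mem_maximalAtlas (f x)
    have hxe : f x ∈ e.source := mem_chart_source _ _
    -- On a ball mapped into a single chart domain the coordinates of `f` are constant by convexity
    -- of the ball, and injectivity of `e` transfers this to `f`.
    obtain ⟨r, hr, hball⟩ := Metric.mem_nhds_iff.1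
      ((e.open_source.preimage hf.continuous).mem_nhds hxe)
    have hd : ∀ y ∈ Metric.ball x r, ∀ k, HasFDerivAt (coordFun e f k) 0 y := fun y hy k => by
      have hu := contDiffAt_chart_comp hf he (hball hy)
      have huk : DifferentiableAt ℝ (coordFun e f k) y :=
        (EuclideanSpace.proj k : Euc n →L[ℝ] ℝ).differentiableAt.comp y
          (hu.differentiableAt (by norm_num))
      convert huk.hasFDerivAt using 1
      ext v
      rw [fderiv_apply_eq_sum_partialDeriv]
      simp [h0 y e he (hball hy)]
    filter_upwards [Metric.ball_mem_nhds x hr] with y hy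
    refine e.injOn (hball hy) hxe ?_
    ext k
    exact (convex_ball x r).is_const_of_fderivWithin_eq_zero (𝕜 := ℝ) (f := coordFun e f k)
      (fun z hz => (hd z hz k).differentiableAt.differentiableWithinAt)
      (fun z hz => (hd z hz k).hasFDerivWithinAt.fderivWithin
        (Metric.isOpen_ball.uniqueDiffWithinAt hz)) hy (Metric.mem_ball_self hr)
  exact ⟨f 0, fun x => hloc.apply_eq_of_isPreconnected isPreconnected_univ trivial trivial⟩

end ConvexSoliton

theorem mainTheorem7 {m n : ℕ} {N : Type*} [TopologicalSpace N] [T2Space N]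
    [SecondCountableTopology N] [ChartedSpace (ConvexSoliton.Euc n) N]
    [IsManifold 𝓘(ℝ, ConvexSoliton.Euc n) ∞ N]
    (h : ConvexSoliton.RiemannianMetric n N)
    (U : Set N) (hU : ConvexSoliton.IsConvexSupporting h U)
    (f : ConvexSoliton.Euc m → N) (hf : ConvexSoliton.IsSoliton h f)
    (hfU : ∃ K : Set N, IsCompact K ∧ K ⊆ U ∧ Set.range f ⊆ K) :
    ∃ p : N, ∀ x : ConvexSoliton.Euc m, f x = p := by
  open ConvexSoliton in
  obtain ⟨K, hK, hKU, hfK⟩ := hfU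
  obtain ⟨V, F, hV, hKV, hF⟩ := hU K hKU hK
  have hxK : ∀ x, f x ∈ K := fun x => hfK ⟨x, rfl⟩
  have hxV : ∀ x, f x ∈ V := fun x => hKV (hxK x)
  obtain ⟨B, hB⟩ := hK.bddAbove_image (hF.contMDiffOn.continuousOn.mono hKV)
  have hφ : ContDiff ℝ 2 (fun y => F (f y)) := contDiff_iff_contDiffAt.2 fun x =>
    ((hF.contMDiffOn.contMDiffAt (hV.mem_nhds (hxV x))).comp x
      ((hf.contMDiff x).of_le (by norm_cast))).contDiffAt
  have key := fun x e (he : e ∈ smoothCharts n N) (hx : f x ∈ e.source) =>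
    hf.laplacian_comp hV hF.contMDiffOn he hx (hxV x)
  have hQ : ∀ x, ∀ e ∈ smoothCharts n N, f x ∈ e.source → ∀ α,
      0 ≤ ∑ i, ∑ j, hessianCoeff h e F i j (e (f x)) *
        partialDeriv α (coordFun e f i) x * partialDeriv α (coordFun e f j) x :=
    fun x e he hx α => hF.hessian_nonneg (hxV x) he hx
      (WithLp.toLp 2 fun i => partialDeriv α (coordFun e f i) x)
  have hconst := liouville hφ (B := B) (fun x => hB ⟨f x, hxK x, rfl⟩) fun x => by
    have he := IsManifold.chart_mem_maximalAtlas (I := 𝓘(ℝ, Euc n)) (n := ∞) (f x)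
    have hx := mem_chart_source (Euc n) (f x)
    rw [key x _ he hx]
    exact le_add_of_nonneg_left (Finset.sum_nonneg fun α _ => hQ x _ he hx α)
  have hφ0 : (fun y => F (f y)) = fun _ => F (f 0) := funext fun x => hconst x 0
  refine exists_eq_const_of_partialDeriv_eq_zero hf.contMDiff fun x e he hx α k => ?_
  have h1 := key x e he hx
  have hz : ∀ (β : Fin m) (c : ℝ), partialDeriv β (fun _ : Euc m => c) = fun _ => 0 := fun β c => by
    funext y
    simp [partialDeriv]
  -- With `F ∘ f` constant, only the sum of Hessian terms survives. Its summands are nonnegative, so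
  -- each vanishes.
  simp only [hφ0, hz, mul_zero, Finset.sum_const_zero, add_zero] at h1
  have h2 := (Finset.sum_eq_zero_iff_of_nonneg fun β _ => hQ x e he hx β).1 h1.symm α
    (Finset.mem_univ α)
  by_contra hne
  refine (hF.hessian_pos (f x) (hxV x) e he hx
    (WithLp.toLp 2 fun i => partialDeriv α (coordFun e f i) x) fun hv => hne ?_).ne' h2
  exact congrArg (fun v : Euc n => v k) hv
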